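/- For real $k$ with $k^2<1$ let $F(\varphi,k)=\int_0^{\varphi}\frac{d\theta}{\sqrt{1-k^2\sin^2\theta}}$, let $\mathrm{am}(\cdot,k):\mathbb R\to\mathbb R$ be the inverse of the bijection $\varphi\mapsto F(\varphi,k)$, and let $\mathrm{sn}(u,k)=\sin(\mathrm{am}(u,k))$ be Jacobi's sinus amplitudinis. Let $\gamma,\delta,E$ be real with $\gamma>0$, put $Q(v)=\gamma v^4-\delta+2Ev^2$, and consider the first integral $v_t^2=Q(v)$. The quartic $Q$ has four distinct real roots $v_1>v_2>v_3>v_4$ if and only if $\delta<0$ and $E<-\sqrt{-\gamma\delta}$ (for $\gamma=-\delta=1$: if and only if $E<-1$). Assume that this is the case and put $$k=\sqrt{\frac{v_4-v_1}{v_4-v_2}\cdot\frac{v_2-v_3}{v_1-v_3}},\qquad Z(t)=\frac{v_4-v_1}{v_4-v_2}\,\mathrm{sn}^2\!\left(\frac{\sqrt{\gamma}\,\sqrt{(v_3-v_1)(v_4-v_2)}}{2}\,t,\;k\right),$$ $$D(t)=1-Z(t),\qquad V(t)=\frac{v_1-v_2\,Z(t)}{1-Z(t)}.$$ For $\gamma=-\delta=1$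 the argument of $\mathrm{sn}$ is $\sqrt{(v_3-v_1)(v_4-v_2)}\,t/2$. Then: 1. $k^2=\frac{v_4-v_1}{v_4-v_2}\cdot\frac{v_2-v_3}{v_1-v_3}$ and $0<k<1$. 2. $V(0)=v_1$, and at every real $t$ with $D(t)\neq 0$ the function $V$ is differentiable and $V'(t)^2=Q(V(t))$. 3. $V$ is the inversion of the elliptic integral based at $v_1$: for every $x\ge v_1$ the function $1/\sqrt{Q}$ is integrable on $[v_1,x]$, and for every $t\ge 0$ one has $\int_{v_1}^{x}\frac{ds}{\sqrt{Q(s)}}=t$ if and only if $D>0$ on $[0,t]$ and $x=V(t)$. 4. Let $a<b$ and let $v:(a,b)\to\mathbb R$ be differentiable with $v>v_1$ and $v_t^2=Q(v)$ on $(a,b)$. Then there is a real $t_0$ such that $D(t-t_0)\neq 0$ and $v(t)=V(t-t_0)$ for all $t\in(a,b)$. -/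

import Mathlib

noncomputable section

namespace Elliptic

/-- Legendre's incomplete elliptic integral of the first kind
`F(φ, k) = ∫₀^φ dθ / √(1 - k² sin² θ)`. -/
def legendreF (k φ : ℝ) : ℝ :=
  ∫ θ in (0 : ℝ)..φ, 1 / √(1 - k ^ 2 * Real.sin θ ^ 2)

/-- Jacobi's amplitude `am(u, k)`: the inverse function of `φ ↦ F(φ, k)`, which is a bijection
of `ℝ` when `k² < 1` (see `legendreF_bijective`). -/
def am (u k : ℝ) : ℝ :=
  Function.invFun (legendreF k) u

/-- Jacobi's sinus amplitudinis `sn(u, k) = sin (am(u, k))`. -/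
def sn (u k : ℝ) : ℝ :=
  Real.sin (am u k)

lemma radicand_pos {k : ℝ} (hk : k ^ 2 < 1) (θ : ℝ) :
    0 < 1 - k ^ 2 * Real.sin θ ^ 2 := by
  nlinarith [Real.sin_sq_le_one θ, sq_nonneg (Real.sin θ), sq_nonneg k]

lemma integrand_continuous {k : ℝ} (hk : k ^ 2 < 1) :
    Continuous fun θ : ℝ => 1 / √(1 - k ^ 2 * Real.sin θ ^ 2) := by
  refine Continuous.div continuous_const (by fun_prop) fun θ => ?_
  exact (Real.sqrt_pos.2 (radicand_pos hk θ)).ne'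

lemma one_le_integrand {k : ℝ} (hk : k ^ 2 < 1) (θ : ℝ) :
    1 ≤ 1 / √(1 - k ^ 2 * Real.sin θ ^ 2) := by
  rw [le_div_iff₀ (Real.sqrt_pos.2 (radicand_pos hk θ)), one_mul]
  exact Real.sqrt_le_one.2 (by nlinarith [mul_nonneg (sq_nonneg k) (sq_nonneg (Real.sin θ))])

lemma legendreF_hasDerivAt {k : ℝ} (hk : k ^ 2 < 1) (φ : ℝ) :
    HasDerivAt (legendreF k) (1 / √(1 - k ^ 2 * Real.sin φ ^ 2)) φ :=
  (integrand_continuous hk).integral_hasStrictDerivAt 0 φ |>.hasDerivAt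

lemma sub_le_legendreF_sub {k : ℝ} (hk : k ^ 2 < 1) {a b : ℝ} (hab : a ≤ b) :
    b - a ≤ legendreF k b - legendreF k a := by
  have hd : Differentiable ℝ (legendreF k) := fun x =>
    (legendreF_hasDerivAt hk x).differentiableAt
  have h := mul_sub_le_image_sub_of_le_deriv hd (C := 1)
    (fun x => by rw [(legendreF_hasDerivAt hk x).deriv]; exact one_le_integrand hk x) hab
  linarith

lemma legendreF_bijective {k : ℝ} (hk : k ^ 2 < 1) : Function.Bijective (legendreF k) := by
  have h0 : legendreF k 0 = 0 := by simp [legendreF]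
  have hmono : StrictMono (legendreF k) := fun a b hab => by
    have := sub_le_legendreF_sub hk hab.le
    linarith
  refine ⟨hmono.injective, Continuous.surjective ?_ ?_ ?_⟩
  · exact continuous_iff_continuousAt.2 fun x => (legendreF_hasDerivAt hk x).continuousAt
  · refine Filter.tendsto_atTop_mono' _ ?_ Filter.tendsto_id
    filter_upwards [Filter.eventually_ge_atTop (0 : ℝ)] with x hx
    have := sub_le_legendreF_sub hk hx
    simp only [id]
    linarith
  · refine Filter.tendsto_atBot_mono' _ ?_ Filter.tendsto_id
    filter_upwards [Filter.eventually_le_atBot (0 : ℝ)] with x hx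
    have := sub_le_legendreF_sub hk hx
    simp only [id]
    linarith

/-- The right-hand side `γ v⁴ - δ + 2 E v²` of the first integral. -/
def quartic (γ δ E v : ℝ) : ℝ :=
  γ * v ^ 4 - δ + 2 * E * v ^ 2

/-- `v₁ > v₂ > v₃ > v₄` are (all) the roots of the quartic. -/
structure IsOrderedRoots (γ δ E v₁ v₂ v₃ v₄ : ℝ) : Prop where
  lt₁₂ : v₂ < v₁
  lt₂₃ : v₃ < v₂
  lt₃₄ : v₄ < v₃
  root₁ : quartic γ δ E v₁ = 0
  root₂ : quartic γ δ E v₂ = 0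
  root₃ : quartic γ δ E v₃ = 0
  root₄ : quartic γ δ E v₄ = 0

/-- The expression for the squared modulus in terms of the roots. -/
def modulusSq (v₁ v₂ v₃ v₄ : ℝ) : ℝ :=
  (v₄ - v₁) / (v₄ - v₂) * ((v₂ - v₃) / (v₁ - v₃))

/-- The Jacobi modulus `k ≥ 0`. -/
def modulus (v₁ v₂ v₃ v₄ : ℝ) : ℝ :=
  √(modulusSq v₁ v₂ v₃ v₄)

/-- `(v₄ - v₁) / (v₄ - v₂) * sn² (√γ √((v₃ - v₁)(v₄ - v₂)) t / 2, k)`. -/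
def scaledSnSq (γ v₁ v₂ v₃ v₄ t : ℝ) : ℝ :=
  (v₄ - v₁) / (v₄ - v₂) *
    sn (√γ * √((v₃ - v₁) * (v₄ - v₂)) / 2 * t) (modulus v₁ v₂ v₃ v₄) ^ 2

/-- The denominator of the Möbius expression in `sn²`. -/
def den (γ v₁ v₂ v₃ v₄ t : ℝ) : ℝ :=
  1 - scaledSnSq γ v₁ v₂ v₃ v₄ t

/-- The Möbius expression in `sn²`. -/
def snSolution (γ v₁ v₂ v₃ v₄ t : ℝ) : ℝ :=
  (v₁ - v₂ * scaledSnSq γ v₁ v₂ v₃ v₄ t) / den γ v₁ v₂ v₃ v₄ t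

end Elliptic

end

/-!
Let `v₁ > v₂ > v₃ > v₄` be the roots and write `s = sn u`, `Z = A s²` with
`A = (v₁ - v₄) / (v₂ - v₄) > 1`. The Möbius map `Z ↦ V = (v₁ - v₂ Z) / (1 - Z)` is built so that the
four differences `V - vᵢ` are constant multiples of `Z`, `1`, `dn² u`, `cn² u` over `1 - Z`. Their
product is therefore a perfect square, and it is the square of `V'` because `sn' = cn dn`.

On the first quarter period `Z` increases from `0` to `A > 1`, so before `Z` reaches `1` the
function `V` increases from `v₁` through all of `[v₁, ∞)` and satisfies `V' = √Q(V)`. Separation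
of variables then gives the elliptic integral. For any solution `v > v₁`, the elliptic integral
from `v₁` to `v(t)` has derivative `±1` with a constant sign, so `v` is a translate of `V` or of
its reflection, and `V` is even.
-/

namespace Elliptic

open Real Set MeasureTheory

section FirstIntegral

lemma strictMonoOn_of_hasDerivAt_pos {V V' : ℝ → ℝ} {a b : ℝ}
    (hV : ContinuousOn V (Icc a b)) (hV' : ∀ s ∈ Ioo a b, HasDerivAt V (V' s) s)
    (hpos : ∀ s ∈ Ioo a b, 0 < V' s) : StrictMonoOn V (Icc a b) := by
  refine strictMonoOn_of_deriv_pos (convex_Icc a b) hV fun s hs => ?_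
  rw [interior_Icc] at hs
  exact (hV' s hs).deriv ▸ hpos s hs

variable {f V : ℝ → ℝ} {a b : ℝ}

lemma intervalIntegrable_one_div_of_hasDerivAt (hab : a ≤ b) (hV : ContinuousOn V (Icc a b))
    (hV' : ∀ s ∈ Ioo a b, HasDerivAt V (f (V s)) s) (hf : ∀ s ∈ Ioo a b, 0 < f (V s)) :
    IntervalIntegrable (fun x => 1 / f x) volume (V a) (V b) := by
  have hmono := strictMonoOn_of_hasDerivAt_pos hV hV' hf
  have hV_le : V a ≤ V b := hmono.monotoneOn (left_mem_Icc.2 hab) (right_mem_Icc.2 hab) hab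
  rw [intervalIntegrable_iff_integrableOn_Ioo_of_le hV_le,
    ← hV.image_Ioo_of_strictMonoOn hab hmono,
    integrableOn_image_iff_integrableOn_deriv_smul_of_monotoneOn measurableSet_Ioo
      (fun s hs => (hV' s hs).hasDerivWithinAt) (hmono.monotoneOn.mono Ioo_subset_Icc_self)]
  refine (integrableOn_const (C := (1 : ℝ)) (by simp)).congr_fun (fun s hs => ?_) measurableSet_Ioo
  exact (mul_one_div_cancel (hf s hs).ne').symm

lemma integral_one_div_of_hasDerivAt (hab : a ≤ b) (hV : ContinuousOn V (Icc a b))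
    (hV' : ∀ s ∈ Ioo a b, HasDerivAt V (f (V s)) s) (hf : ∀ s ∈ Ioo a b, 0 < f (V s)) :
    ∫ x in V a..V b, 1 / f x = b - a := by
  have hmono := strictMonoOn_of_hasDerivAt_pos hV hV' hf
  have hV_le : V a ≤ V b := hmono.monotoneOn (left_mem_Icc.2 hab) (right_mem_Icc.2 hab) hab
  have hcancel : EqOn (fun s => f (V s) • (1 / f (V s))) (fun _ => 1) (Ioo a b) := fun s hs =>
    mul_one_div_cancel (hf s hs).ne'
  rw [intervalIntegral.integral_of_le hV_le, integral_Ioc_eq_integral_Ioo,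
    ← hV.image_Ioo_of_strictMonoOn hab hmono,
    integral_image_eq_integral_deriv_smul_of_monotoneOn measurableSet_Ioo
      (fun s hs => (hV' s hs).hasDerivWithinAt) (hmono.monotoneOn.mono Ioo_subset_Icc_self),
    setIntegral_congr_fun measurableSet_Ioo hcancel]
  simp [hab]

lemma hasDerivAt_comp_of_sq_eq {Q G v : ℝ → ℝ} {v' t : ℝ} (hv : HasDerivAt v v' t)
    (hG : HasDerivAt G (1 / √(Q (v t))) (v t)) (hQ : v' ^ 2 = Q (v t)) :
    HasDerivAt (fun t => G (v t)) (v' / |v'|) t := by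
  rw [← hQ, sqrt_sq_eq_abs] at hG
  exact (hG.comp t hv).congr_deriv (by ring)

lemma exists_eq_add_const_of_hasDerivAt {g : ℝ → ℝ} {σ : ℝ}
    (hg : ∀ t ∈ Ioo a b, HasDerivAt g σ t) : ∃ c, ∀ t ∈ Ioo a b, g t = σ * t + c := by
  have hd : ∀ t ∈ Ioo a b, HasDerivAt (fun t => g t - σ * t) 0 t := fun t ht => by
    simpa using! (hg t ht).sub ((hasDerivAt_id t).const_mul σ)
  obtain ⟨c, hc⟩ := isOpen_Ioo.exists_is_const_of_deriv_eq_zero isPreconnected_Ioo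
    (fun t ht => (hd t ht).differentiableAt.differentiableWithinAt) fun t ht => (hd t ht).deriv
  exact ⟨c, fun t ht => by linarith [hc t ht]⟩

lemma exists_shift_of_sq_deriv_eq {Q G v v' : ℝ → ℝ}
    (hG : ∀ t ∈ Ioo a b, HasDerivAt G (1 / √(Q (v t))) (v t))
    (hv : ∀ t ∈ Ioo a b, HasDerivAt v (v' t) t) (hv' : ∀ t ∈ Ioo a b, v' t ^ 2 = Q (v t))
    (hQ : ∀ t ∈ Ioo a b, 0 < Q (v t)) :
    ∃ t₀, (∀ t ∈ Ioo a b, G (v t) = t - t₀) ∨ ∀ t ∈ Ioo a b, G (v t) = -(t - t₀) := by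
  have hne : ∀ t ∈ Ioo a b, v' t ≠ 0 := fun t ht h0 => by
    simpa [← hv' t ht, h0] using hQ t ht
  have hGv : ∀ t ∈ Ioo a b, HasDerivAt (fun t => G (v t)) (v' t / |v' t|) t := fun t ht =>
    hasDerivAt_comp_of_sq_eq (hv t ht) (hG t ht) (hv' t ht)
  -- Derivatives have the Darboux property, so `v'` has constant sign.
  rcases hasDerivWithinAt_forall_lt_or_forall_gt_of_forall_ne (convex_Ioo a b)
    (fun t ht => (hv t ht).hasDerivWithinAt) hne with hneg | hpos
  · obtain ⟨c, hc⟩ := exists_eq_add_const_of_hasDerivAt (σ := -1) fun t ht =>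
      (hGv t ht).congr_deriv (by rw [abs_of_neg (hneg t ht), div_neg, div_self (hne t ht)])
    exact ⟨c, Or.inr fun t ht => by rw [hc t ht]; ring⟩
  · obtain ⟨c, hc⟩ := exists_eq_add_const_of_hasDerivAt (σ := 1) fun t ht =>
      (hGv t ht).congr_deriv (by rw [abs_of_pos (hpos t ht), div_self (hne t ht)])
    exact ⟨-c, Or.inl fun t ht => by rw [hc t ht]; ring⟩

end FirstIntegral

section JacobiFunctions

/-- Jacobi's cosinus amplitudinis `cn(u, k) = cos (am(u, k))`. -/
noncomputable def cn (u k : ℝ) : ℝ :=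
  cos (am u k)

/-- Jacobi's delta amplitudinis `dn(u, k) = √(1 - k² sn²(u, k))`, for `k² < 1` the derivative of
`am(·, k)`. -/
noncomputable def dn (u k : ℝ) : ℝ :=
  √(1 - k ^ 2 * sn u k ^ 2)

/-- The complete elliptic integral `K(k) = F(π / 2, k)`, a quarter of the period of `sn`. -/
noncomputable def quarterPeriod (k : ℝ) : ℝ :=
  legendreF k (π / 2)

lemma legendreF_zero (k : ℝ) : legendreF k 0 = 0 :=
  intervalIntegral.integral_same

lemma legendreF_neg (k φ : ℝ) : legendreF k (-φ) = -legendreF k φ := by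
  have h := intervalIntegral.integral_comp_neg (a := 0) (b := φ)
    fun θ => 1 / √(1 - k ^ 2 * sin θ ^ 2)
  simp only [sin_neg, neg_sq, neg_zero] at h
  rw [legendreF, legendreF, intervalIntegral.integral_symm, h]

lemma cn_sq (u k : ℝ) : cn u k ^ 2 = 1 - sn u k ^ 2 :=
  cos_sq' _

variable {k : ℝ} (hk : k ^ 2 < 1)
include hk

lemma dn_pos (u : ℝ) : 0 < dn u k :=
  sqrt_pos.2 (radicand_pos hk _)

lemma dn_sq (u : ℝ) : dn u k ^ 2 = 1 - k ^ 2 * sn u k ^ 2 :=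
  sq_sqrt (radicand_pos hk _).le

lemma strictMono_legendreF : StrictMono (legendreF k) := fun a b hab => by
  linarith [sub_le_legendreF_sub hk hab.le]

lemma legendreF_am (u : ℝ) : legendreF k (am u k) = u :=
  Function.invFun_eq ((legendreF_bijective hk).2 u)

lemma am_legendreF (φ : ℝ) : am (legendreF k φ) k = φ :=
  Function.leftInverse_invFun (legendreF_bijective hk).1 φ

lemma strictMono_am : StrictMono fun u => am u k := fun u v huv => by
  rwa [← (strictMono_legendreF hk).lt_iff_lt, legendreF_am hk, legendreF_am hk]

lemma am_zero : am 0 k = 0 := by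
  simpa only [legendreF_zero] using am_legendreF hk 0

lemma am_neg (u : ℝ) : am (-u) k = -am u k := by
  apply (strictMono_legendreF hk).injective
  rw [legendreF_am hk, legendreF_neg, legendreF_am hk]

lemma am_quarterPeriod : am (quarterPeriod k) k = π / 2 :=
  am_legendreF hk _

lemma quarterPeriod_pos : 0 < quarterPeriod k :=
  (legendreF_zero k).symm.trans_lt (strictMono_legendreF hk pi_div_two_pos)

lemma continuous_am : Continuous fun u => am u k :=
  (strictMono_am hk).monotone.continuous_of_surjective fun φ => ⟨_, am_legendreF hk φ⟩

lemma hasDerivAt_am (u : ℝ) : HasDerivAt (fun u => am u k) (dn u k) u := by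
  have h := HasDerivAt.of_local_left_inverse (continuous_am hk).continuousAt
    (legendreF_hasDerivAt hk (am u k)) (one_div_ne_zero (dn_pos hk u).ne')
    (Filter.Eventually.of_forall (legendreF_am hk))
  rwa [one_div, inv_inv] at h

lemma sn_zero : sn 0 k = 0 := by
  rw [sn, am_zero hk, sin_zero]

lemma sn_neg (u : ℝ) : sn (-u) k = -sn u k := by
  rw [sn, am_neg hk, sin_neg, sn]

lemma sn_quarterPeriod : sn (quarterPeriod k) k = 1 := by
  rw [sn, am_quarterPeriod hk, sin_pi_div_two]

lemma hasDerivAt_sn (u : ℝ) : HasDerivAt (fun u => sn u k) (cn u k * dn u k) u :=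
  (hasDerivAt_am hk u).sin

lemma am_mem_Ioo {u : ℝ} (hu : u ∈ Ioo 0 (quarterPeriod k)) : am u k ∈ Ioo 0 (π / 2) := by
  rw [← am_zero hk, ← am_quarterPeriod hk]
  exact ⟨strictMono_am hk hu.1, strictMono_am hk hu.2⟩

lemma sn_pos {u : ℝ} (hu : u ∈ Ioo 0 (quarterPeriod k)) : 0 < sn u k :=
  have h := am_mem_Ioo hk hu
  sin_pos_of_pos_of_lt_pi h.1 (by linarith [h.2, pi_pos])

lemma cn_pos {u : ℝ} (hu : u ∈ Ioo 0 (quarterPeriod k)) : 0 < cn u k :=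
  have h := am_mem_Ioo hk hu
  cos_pos_of_mem_Ioo ⟨by linarith [h.1, pi_pos], h.2⟩

lemma strictMonoOn_sn : StrictMonoOn (fun u => sn u k) (Icc 0 (quarterPeriod k)) :=
  strictMonoOn_of_hasDerivAt_pos
    (fun u _ => (hasDerivAt_sn hk u).continuousAt.continuousWithinAt)
    (fun u _ => hasDerivAt_sn hk u) fun u hu => mul_pos (cn_pos hk hu) (dn_pos hk u)

end JacobiFunctions

section RootQuartic

variable {γ v₁ v₂ v₃ v₄ : ℝ}

/-- The quartic with leading coefficient `γ` and roots `v₁, v₂, v₃, v₄`. -/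
def rootQuartic (γ v₁ v₂ v₃ v₄ v : ℝ) : ℝ :=
  γ * ((v - v₁) * (v - v₂) * (v - v₃) * (v - v₄))

/-- The factor of `t` in the argument of `sn` in `scaledSnSq`. -/
noncomputable def frequency (γ v₁ v₂ v₃ v₄ : ℝ) : ℝ :=
  √γ * √((v₃ - v₁) * (v₄ - v₂)) / 2

/-- The derivative of `snSolution` away from its poles. -/
noncomputable def snVelocity (γ v₁ v₂ v₃ v₄ t : ℝ) : ℝ :=
  let u := frequency γ v₁ v₂ v₃ v₄ * t
  let k := modulus v₁ v₂ v₃ v₄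
  2 * (v₁ - v₂) * ((v₄ - v₁) / (v₄ - v₂)) * frequency γ v₁ v₂ v₃ v₄ *
    (sn u k * cn u k * dn u k) / den γ v₁ v₂ v₃ v₄ t ^ 2

lemma snSolution_sub_root₁ {t : ℝ} (ht : den γ v₁ v₂ v₃ v₄ t ≠ 0) :
    snSolution γ v₁ v₂ v₃ v₄ t - v₁ =
      (v₁ - v₂) * scaledSnSq γ v₁ v₂ v₃ v₄ t / den γ v₁ v₂ v₃ v₄ t := by
  rw [snSolution, div_sub' ht, den]
  ring

lemma snSolution_sub_root₂ {t : ℝ} (ht : den γ v₁ v₂ v₃ v₄ t ≠ 0) :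
    snSolution γ v₁ v₂ v₃ v₄ t - v₂ = (v₁ - v₂) / den γ v₁ v₂ v₃ v₄ t := by
  rw [snSolution, div_sub' ht, den]
  ring

lemma snSolution_sub_root₄ (h₂₄ : v₄ ≠ v₂) {t : ℝ} (ht : den γ v₁ v₂ v₃ v₄ t ≠ 0) :
    snSolution γ v₁ v₂ v₃ v₄ t - v₄ =
      (v₁ - v₄) * cn (frequency γ v₁ v₂ v₃ v₄ * t) (modulus v₁ v₂ v₃ v₄) ^ 2 /
        den γ v₁ v₂ v₃ v₄ t := by
  have h₄₂ : v₄ - v₂ ≠ 0 := sub_ne_zero.2 h₂₄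
  rw [cn_sq, snSolution, div_sub' ht, den, scaledSnSq, ← frequency]
  congr 1
  field_simp
  ring

lemma rootQuartic_pos (hγ : 0 < γ) (h₁₂ : v₂ < v₁) (h₂₃ : v₃ < v₂) (h₃₄ : v₄ < v₃) {x : ℝ}
    (hx : v₁ < x) : 0 < rootQuartic γ v₁ v₂ v₃ v₄ x :=
  have hx₂ := h₁₂.trans hx
  have hx₃ := h₂₃.trans hx₂
  have hx₄ := h₃₄.trans hx₃
  mul_pos hγ <| mul_pos (mul_pos (mul_pos (sub_pos.2 hx) (sub_pos.2 hx₂)) (sub_pos.2 hx₃))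
    (sub_pos.2 hx₄)

section Ordered

variable (h₁₂ : v₂ < v₁) (h₂₃ : v₃ < v₂) (h₃₄ : v₄ < v₃)
include h₁₂ h₂₃ h₃₄

lemma one_lt_snSq_coeff : 1 < (v₄ - v₁) / (v₄ - v₂) := by
  rw [one_lt_div_of_neg (by linarith)]
  linarith

lemma modulusSq_pos : 0 < modulusSq v₁ v₂ v₃ v₄ :=
  mul_pos (one_pos.trans (one_lt_snSq_coeff h₁₂ h₂₃ h₃₄))
    (div_pos (by linarith) (by linarith))

lemma modulusSq_lt_one : modulusSq v₁ v₂ v₃ v₄ < 1 := by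
  have hden : 0 < (v₂ - v₄) * (v₁ - v₃) := mul_pos (by linarith) (by linarith)
  rw [modulusSq, ← neg_div_neg_eq, neg_sub, neg_sub, div_mul_div_comm, div_lt_one hden]
  linarith [mul_pos (sub_pos.2 h₁₂) (sub_pos.2 h₃₄)]

lemma modulus_sq : modulus v₁ v₂ v₃ v₄ ^ 2 = modulusSq v₁ v₂ v₃ v₄ :=
  sq_sqrt (modulusSq_pos h₁₂ h₂₃ h₃₄).le

lemma modulus_pos : 0 < modulus v₁ v₂ v₃ v₄ :=
  sqrt_pos.2 (modulusSq_pos h₁₂ h₂₃ h₃₄)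

lemma modulus_sq_lt_one : modulus v₁ v₂ v₃ v₄ ^ 2 < 1 :=
  (modulus_sq h₁₂ h₂₃ h₃₄).trans_lt (modulusSq_lt_one h₁₂ h₂₃ h₃₄)

lemma modulus_lt_one : modulus v₁ v₂ v₃ v₄ < 1 :=
  (sq_lt_one_iff₀ (modulus_pos h₁₂ h₂₃ h₃₄).le).1 (modulus_sq_lt_one h₁₂ h₂₃ h₃₄)

lemma frequency_pos (hγ : 0 < γ) : 0 < frequency γ v₁ v₂ v₃ v₄ := by
  have hprod : 0 < (v₃ - v₁) * (v₄ - v₂) := mul_pos_of_neg_of_neg (by linarith) (by linarith)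
  unfold frequency
  positivity

lemma frequency_sq (hγ : 0 < γ) :
    frequency γ v₁ v₂ v₃ v₄ ^ 2 = γ * ((v₃ - v₁) * (v₄ - v₂)) / 4 := by
  have hprod : 0 < (v₃ - v₁) * (v₄ - v₂) := mul_pos_of_neg_of_neg (by linarith) (by linarith)
  rw [frequency, div_pow, mul_pow, sq_sqrt hγ.le, sq_sqrt hprod.le]
  norm_num

lemma scaledSnSq_zero : scaledSnSq γ v₁ v₂ v₃ v₄ 0 = 0 := by
  rw [scaledSnSq, mul_zero, sn_zero (modulus_sq_lt_one h₁₂ h₂₃ h₃₄), zero_pow two_ne_zero,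
    mul_zero]

lemma snSolution_zero : snSolution γ v₁ v₂ v₃ v₄ 0 = v₁ := by
  rw [snSolution, den, scaledSnSq_zero h₁₂ h₂₃ h₃₄, mul_zero, sub_zero, sub_zero, div_one]

lemma scaledSnSq_neg (t : ℝ) :
    scaledSnSq γ v₁ v₂ v₃ v₄ (-t) = scaledSnSq γ v₁ v₂ v₃ v₄ t := by
  rw [scaledSnSq, mul_neg, sn_neg (modulus_sq_lt_one h₁₂ h₂₃ h₃₄), neg_sq, scaledSnSq]

lemma den_neg (t : ℝ) : den γ v₁ v₂ v₃ v₄ (-t) = den γ v₁ v₂ v₃ v₄ t := by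
  rw [den, scaledSnSq_neg h₁₂ h₂₃ h₃₄, den]

lemma snSolution_neg (t : ℝ) :
    snSolution γ v₁ v₂ v₃ v₄ (-t) = snSolution γ v₁ v₂ v₃ v₄ t := by
  rw [snSolution, scaledSnSq_neg h₁₂ h₂₃ h₃₄, den_neg h₁₂ h₂₃ h₃₄, snSolution]

lemma snSolution_sub_root₃ {t : ℝ} (ht : den γ v₁ v₂ v₃ v₄ t ≠ 0) :
    snSolution γ v₁ v₂ v₃ v₄ t - v₃ =
      (v₁ - v₃) * dn (frequency γ v₁ v₂ v₃ v₄ * t) (modulus v₁ v₂ v₃ v₄) ^ 2 /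
        den γ v₁ v₂ v₃ v₄ t := by
  have h₁₃ : v₁ - v₃ ≠ 0 := by linarith
  rw [dn_sq (modulus_sq_lt_one h₁₂ h₂₃ h₃₄), modulus_sq h₁₂ h₂₃ h₃₄, modulusSq, snSolution,
    div_sub' ht, den, scaledSnSq, ← frequency]
  congr 1
  field_simp
  ring

lemma hasDerivAt_scaledSnSq (t : ℝ) :
    let u := frequency γ v₁ v₂ v₃ v₄ * t
    let k := modulus v₁ v₂ v₃ v₄
    HasDerivAt (scaledSnSq γ v₁ v₂ v₃ v₄)
      (2 * ((v₄ - v₁) / (v₄ - v₂)) * frequency γ v₁ v₂ v₃ v₄ * (sn u k * cn u k * dn u k)) t := by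
  intro u k
  have hsn : HasDerivAt (fun t => sn (frequency γ v₁ v₂ v₃ v₄ * t) k)
      (cn u k * dn u k * (frequency γ v₁ v₂ v₃ v₄ * 1)) t :=
    (hasDerivAt_sn (modulus_sq_lt_one h₁₂ h₂₃ h₃₄) u).comp t ((hasDerivAt_id t).const_mul _)
  exact ((hsn.pow 2).const_mul _).congr_deriv (by push_cast; ring)

lemma hasDerivAt_snSolution {t : ℝ} (ht : den γ v₁ v₂ v₃ v₄ t ≠ 0) :
    HasDerivAt (snSolution γ v₁ v₂ v₃ v₄) (snVelocity γ v₁ v₂ v₃ v₄ t) t := by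
  have hZ := hasDerivAt_scaledSnSq (γ := γ) h₁₂ h₂₃ h₃₄ t
  refine (((hZ.const_mul v₂).const_sub v₁).div (hZ.const_sub 1) ht).congr_deriv ?_
  rw [snVelocity, ← den]
  congr 1
  rw [den]
  ring

lemma snVelocity_sq (hγ : 0 < γ) {t : ℝ} (ht : den γ v₁ v₂ v₃ v₄ t ≠ 0) :
    snVelocity γ v₁ v₂ v₃ v₄ t ^ 2 =
      rootQuartic γ v₁ v₂ v₃ v₄ (snSolution γ v₁ v₂ v₃ v₄ t) := by
  have h₄₂ : v₄ - v₂ ≠ 0 := by linarith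
  rw [rootQuartic, snSolution_sub_root₁ ht, snSolution_sub_root₂ ht,
    snSolution_sub_root₃ h₁₂ h₂₃ h₃₄ ht, snSolution_sub_root₄ (h₃₄.trans h₂₃).ne ht, snVelocity,
    div_pow, mul_pow, mul_pow _ (frequency _ _ _ _ _), frequency_sq h₁₂ h₂₃ h₃₄ hγ, scaledSnSq,
    ← frequency]
  field_simp
  ring

lemma scaledSnSq_quarterPeriod (hγ : 0 < γ) :
    scaledSnSq γ v₁ v₂ v₃ v₄ (quarterPeriod (modulus v₁ v₂ v₃ v₄) / frequency γ v₁ v₂ v₃ v₄) =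
      (v₄ - v₁) / (v₄ - v₂) := by
  rw [scaledSnSq, ← frequency, mul_div_cancel₀ _ (frequency_pos h₁₂ h₂₃ h₃₄ hγ).ne',
    sn_quarterPeriod (modulus_sq_lt_one h₁₂ h₂₃ h₃₄), one_pow, mul_one]

lemma frequency_mul_mem_Icc (hγ : 0 < γ) {t : ℝ}
    (ht : t ∈ Icc 0 (quarterPeriod (modulus v₁ v₂ v₃ v₄) / frequency γ v₁ v₂ v₃ v₄)) :
    frequency γ v₁ v₂ v₃ v₄ * t ∈ Icc 0 (quarterPeriod (modulus v₁ v₂ v₃ v₄)) := by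
  have hν := frequency_pos h₁₂ h₂₃ h₃₄ hγ
  exact ⟨mul_nonneg hν.le ht.1, (le_div_iff₀' hν).1 ht.2⟩

lemma monotoneOn_scaledSnSq (hγ : 0 < γ) : MonotoneOn (scaledSnSq γ v₁ v₂ v₃ v₄)
    (Icc 0 (quarterPeriod (modulus v₁ v₂ v₃ v₄) / frequency γ v₁ v₂ v₃ v₄)) := by
  intro s hs t ht hst
  have hk := modulus_sq_lt_one h₁₂ h₂₃ h₃₄
  have hs' := frequency_mul_mem_Icc h₁₂ h₂₃ h₃₄ hγ hs
  have ht' := frequency_mul_mem_Icc h₁₂ h₂₃ h₃₄ hγ ht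
  have hcoeff := one_pos.trans (one_lt_snSq_coeff h₁₂ h₂₃ h₃₄)
  have hsn_nonneg : 0 ≤ sn (frequency γ v₁ v₂ v₃ v₄ * s) (modulus v₁ v₂ v₃ v₄) := by
    simpa only [sn_zero hk] using
      (strictMonoOn_sn hk).monotoneOn (left_mem_Icc.2 (quarterPeriod_pos hk).le) hs' hs'.1
  have hsn_le := (strictMonoOn_sn hk).monotoneOn hs' ht'
    (mul_le_mul_of_nonneg_left hst (frequency_pos h₁₂ h₂₃ h₃₄ hγ).le)
  exact mul_le_mul_of_nonneg_left (pow_le_pow_left₀ hsn_nonneg hsn_le 2) hcoeff.le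

lemma exists_snSolution_eq (hγ : 0 < γ) {x : ℝ} (hx : v₁ ≤ x) :
    ∃ t, 0 ≤ t ∧ (∀ s ∈ Icc 0 t, 0 < den γ v₁ v₂ v₃ v₄ s) ∧
      snSolution γ v₁ v₂ v₃ v₄ t = x := by
  have hx₂ : 0 < x - v₂ := by linarith
  have hratio_lt : (x - v₁) / (x - v₂) < 1 := by
    rw [div_lt_one hx₂]
    linarith
  have hT : 0 ≤ quarterPeriod (modulus v₁ v₂ v₃ v₄) / frequency γ v₁ v₂ v₃ v₄ :=
    (div_pos (quarterPeriod_pos (modulus_sq_lt_one h₁₂ h₂₃ h₃₄))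
      (frequency_pos h₁₂ h₂₃ h₃₄ hγ)).le
  have hcont : Continuous (scaledSnSq γ v₁ v₂ v₃ v₄) := continuous_iff_continuousAt.2 fun t =>
    (hasDerivAt_scaledSnSq h₁₂ h₂₃ h₃₄ t).continuousAt
  obtain ⟨t, ht, hZt⟩ : (x - v₁) / (x - v₂) ∈ scaledSnSq γ v₁ v₂ v₃ v₄ ''
      Icc 0 (quarterPeriod (modulus v₁ v₂ v₃ v₄) / frequency γ v₁ v₂ v₃ v₄) := by
    apply intermediate_value_Icc hT hcont.continuousOn
    rw [scaledSnSq_zero h₁₂ h₂₃ h₃₄, scaledSnSq_quarterPeriod h₁₂ h₂₃ h₃₄ hγ]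
    exact ⟨div_nonneg (by linarith) hx₂.le,
      (hratio_lt.trans (one_lt_snSq_coeff h₁₂ h₂₃ h₃₄)).le⟩
  have hden : ∀ s ∈ Icc 0 t, 0 < den γ v₁ v₂ v₃ v₄ s := fun s hs => by
    have := monotoneOn_scaledSnSq h₁₂ h₂₃ h₃₄ hγ ⟨hs.1, hs.2.trans ht.2⟩ ht hs.2
    rw [den]
    linarith
  refine ⟨t, ht.1, hden, ?_⟩
  have hden_t := (hden t (right_mem_Icc.2 ht.1)).ne'
  rw [snSolution, div_eq_iff hden_t, den, hZt]
  field_simp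
  ring

lemma frequency_mul_lt_quarterPeriod (hγ : 0 < γ) {t : ℝ}
    (ht : ∀ s ∈ Icc 0 t, 0 < den γ v₁ v₂ v₃ v₄ s) :
    frequency γ v₁ v₂ v₃ v₄ * t < quarterPeriod (modulus v₁ v₂ v₃ v₄) := by
  have hν := frequency_pos h₁₂ h₂₃ h₃₄ hγ
  by_contra! hle
  have hden := ht (quarterPeriod (modulus v₁ v₂ v₃ v₄) / frequency γ v₁ v₂ v₃ v₄)
    ⟨div_nonneg (quarterPeriod_pos (modulus_sq_lt_one h₁₂ h₂₃ h₃₄)).le hν.le,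
      (div_le_iff₀' hν).2 hle⟩
  rw [den, scaledSnSq_quarterPeriod h₁₂ h₂₃ h₃₄ hγ] at hden
  linarith [one_lt_snSq_coeff h₁₂ h₂₃ h₃₄]

lemma snVelocity_pos (hγ : 0 < γ) {t : ℝ} (ht : 0 < t)
    (hden : ∀ s ∈ Icc 0 t, 0 < den γ v₁ v₂ v₃ v₄ s) : 0 < snVelocity γ v₁ v₂ v₃ v₄ t := by
  have hk := modulus_sq_lt_one h₁₂ h₂₃ h₃₄
  have hν := frequency_pos h₁₂ h₂₃ h₃₄ hγ
  have hu : frequency γ v₁ v₂ v₃ v₄ * t ∈ Ioo 0 (quarterPeriod (modulus v₁ v₂ v₃ v₄)) :=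
    ⟨mul_pos hν ht, frequency_mul_lt_quarterPeriod h₁₂ h₂₃ h₃₄ hγ hden⟩
  have hsn := sn_pos hk hu
  have hcn := cn_pos hk hu
  have hdn := dn_pos hk (frequency γ v₁ v₂ v₃ v₄ * t)
  have hcoeff := one_pos.trans (one_lt_snSq_coeff h₁₂ h₂₃ h₃₄)
  have hden_t := hden t (right_mem_Icc.2 ht.le)
  exact div_pos (mul_pos (mul_pos (mul_pos (mul_pos two_pos (sub_pos.2 h₁₂)) hcoeff) hν)
    (mul_pos (mul_pos hsn hcn) hdn)) (pow_pos hden_t 2)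

lemma snVelocity_eq_sqrt (hγ : 0 < γ) {t : ℝ} (ht : 0 < t)
    (hden : ∀ s ∈ Icc 0 t, 0 < den γ v₁ v₂ v₃ v₄ s) :
    snVelocity γ v₁ v₂ v₃ v₄ t =
      √(rootQuartic γ v₁ v₂ v₃ v₄ (snSolution γ v₁ v₂ v₃ v₄ t)) := by
  rw [← snVelocity_sq h₁₂ h₂₃ h₃₄ hγ (hden t (right_mem_Icc.2 ht.le)).ne',
    sqrt_sq (snVelocity_pos h₁₂ h₂₃ h₃₄ hγ ht hden).le]

lemma integral_snSolution (hγ : 0 < γ) {t : ℝ} (ht : 0 ≤ t)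
    (hden : ∀ s ∈ Icc 0 t, 0 < den γ v₁ v₂ v₃ v₄ s) :
    IntervalIntegrable (fun s => 1 / √(rootQuartic γ v₁ v₂ v₃ v₄ s)) volume v₁
        (snSolution γ v₁ v₂ v₃ v₄ t) ∧
      ∫ s in v₁..snSolution γ v₁ v₂ v₃ v₄ t, 1 / √(rootQuartic γ v₁ v₂ v₃ v₄ s) = t := by
  have hden_le : ∀ s ∈ Ioo 0 t, ∀ r ∈ Icc 0 s, 0 < den γ v₁ v₂ v₃ v₄ r := fun s hs r hr =>
    hden r ⟨hr.1, hr.2.trans hs.2.le⟩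
  have hderiv : ∀ s ∈ Icc 0 t,
      HasDerivAt (snSolution γ v₁ v₂ v₃ v₄) (snVelocity γ v₁ v₂ v₃ v₄ s) s := fun s hs =>
    hasDerivAt_snSolution h₁₂ h₂₃ h₃₄ (hden s hs).ne'
  have hcont : ContinuousOn (snSolution γ v₁ v₂ v₃ v₄) (Icc 0 t) := fun s hs =>
    (hderiv s hs).continuousAt.continuousWithinAt
  have hode : ∀ s ∈ Ioo 0 t, HasDerivAt (snSolution γ v₁ v₂ v₃ v₄)
      √(rootQuartic γ v₁ v₂ v₃ v₄ (snSolution γ v₁ v₂ v₃ v₄ s)) s := fun s hs =>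
    snVelocity_eq_sqrt h₁₂ h₂₃ h₃₄ hγ hs.1 (hden_le s hs) ▸ hderiv s (Ioo_subset_Icc_self hs)
  have hpos : ∀ s ∈ Ioo 0 t,
      0 < √(rootQuartic γ v₁ v₂ v₃ v₄ (snSolution γ v₁ v₂ v₃ v₄ s)) := fun s hs =>
    snVelocity_eq_sqrt h₁₂ h₂₃ h₃₄ hγ hs.1 (hden_le s hs) ▸
      snVelocity_pos h₁₂ h₂₃ h₃₄ hγ hs.1 (hden_le s hs)
  have hint := intervalIntegrable_one_div_of_hasDerivAt
    (f := fun x => √(rootQuartic γ v₁ v₂ v₃ v₄ x)) ht hcont hode hpos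
  have heq := integral_one_div_of_hasDerivAt
    (f := fun x => √(rootQuartic γ v₁ v₂ v₃ v₄ x)) ht hcont hode hpos
  rw [snSolution_zero h₁₂ h₂₃ h₃₄] at hint heq
  exact ⟨hint, heq.trans (sub_zero t)⟩

lemma intervalIntegrable_one_div_sqrt_rootQuartic (hγ : 0 < γ) {x : ℝ} (hx : v₁ ≤ x) :
    IntervalIntegrable (fun s => 1 / √(rootQuartic γ v₁ v₂ v₃ v₄ s)) volume v₁ x := by
  obtain ⟨t, ht, hden, rfl⟩ := exists_snSolution_eq h₁₂ h₂₃ h₃₄ hγ hx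
  exact (integral_snSolution h₁₂ h₂₃ h₃₄ hγ ht hden).1

lemma integral_one_div_sqrt_rootQuartic_eq_iff (hγ : 0 < γ) {x t : ℝ} (hx : v₁ ≤ x)
    (ht : 0 ≤ t) :
    ∫ s in v₁..x, 1 / √(rootQuartic γ v₁ v₂ v₃ v₄ s) = t ↔
      (∀ τ ∈ Icc 0 t, 0 < den γ v₁ v₂ v₃ v₄ τ) ∧ x = snSolution γ v₁ v₂ v₃ v₄ t := by
  constructor
  · rintro rfl
    obtain ⟨τ, hτ, hden, rfl⟩ := exists_snSolution_eq h₁₂ h₂₃ h₃₄ hγ hx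
    rw [(integral_snSolution h₁₂ h₂₃ h₃₄ hγ hτ hden).2]
    exact ⟨hden, rfl⟩
  · rintro ⟨hden, rfl⟩
    exact (integral_snSolution h₁₂ h₂₃ h₃₄ hγ ht hden).2

lemma hasDerivAt_integral_one_div_sqrt_rootQuartic (hγ : 0 < γ) {x : ℝ} (hx : v₁ < x) :
    HasDerivAt (fun x => ∫ s in v₁..x, 1 / √(rootQuartic γ v₁ v₂ v₃ v₄ s))
      (1 / √(rootQuartic γ v₁ v₂ v₃ v₄ x)) x := by
  have hcont : Continuous (rootQuartic γ v₁ v₂ v₃ v₄) := by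
    unfold rootQuartic
    fun_prop
  have hne := (sqrt_pos.2 (rootQuartic_pos hγ h₁₂ h₂₃ h₃₄ hx)).ne'
  exact intervalIntegral.integral_hasDerivAt_right
    (intervalIntegrable_one_div_sqrt_rootQuartic h₁₂ h₂₃ h₃₄ hγ hx.le)
    (hcont.measurable.sqrt.const_div 1).stronglyMeasurable.stronglyMeasurableAtFilter
    (continuousAt_const.div hcont.continuousAt.sqrt hne)

lemma exists_eq_snSolution_sub (hγ : 0 < γ) {a b : ℝ} {v v' : ℝ → ℝ}
    (hv : ∀ t ∈ Ioo a b, v₁ < v t ∧ HasDerivAt v (v' t) t ∧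
      v' t ^ 2 = rootQuartic γ v₁ v₂ v₃ v₄ (v t)) :
    ∃ t₀ : ℝ, ∀ t ∈ Ioo a b, den γ v₁ v₂ v₃ v₄ (t - t₀) ≠ 0 ∧
      v t = snSolution γ v₁ v₂ v₃ v₄ (t - t₀) := by
  have hsol : ∀ t ∈ Ioo a b, ∀ τ,
      ∫ s in v₁..v t, 1 / √(rootQuartic γ v₁ v₂ v₃ v₄ s) = τ →
        den γ v₁ v₂ v₃ v₄ τ ≠ 0 ∧ v t = snSolution γ v₁ v₂ v₃ v₄ τ := fun t ht τ hτ => by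
    have hτ_nonneg : 0 ≤ τ := hτ ▸
      intervalIntegral.integral_nonneg (hv t ht).1.le fun s _ => by positivity
    obtain ⟨hden, heq⟩ := (integral_one_div_sqrt_rootQuartic_eq_iff h₁₂ h₂₃ h₃₄ hγ
      (hv t ht).1.le hτ_nonneg).1 hτ
    exact ⟨(hden τ (right_mem_Icc.2 hτ_nonneg)).ne', heq⟩
  obtain ⟨t₀, hforward | hbackward⟩ := exists_shift_of_sq_deriv_eq
    (fun t ht => hasDerivAt_integral_one_div_sqrt_rootQuartic h₁₂ h₂₃ h₃₄ hγ (hv t ht).1)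
    (fun t ht => (hv t ht).2.1) (fun t ht => (hv t ht).2.2)
    (fun t ht => rootQuartic_pos hγ h₁₂ h₂₃ h₃₄ (hv t ht).1)
  · exact ⟨t₀, fun t ht => hsol t ht _ (hforward t ht)⟩
  · refine ⟨t₀, fun t ht => ?_⟩
    rw [← den_neg h₁₂ h₂₃ h₃₄, ← snSolution_neg h₁₂ h₂₃ h₃₄]
    exact hsol t ht _ (hbackward t ht)

end Ordered

end RootQuartic

section EvenQuartic

open Polynomial in
lemma eval_eq_leadingCoeff_mul_prod_sub {R : Type*} [CommRing R] [IsDomain R] {p : R[X]}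
    {S : Finset R} (hS : ∀ a ∈ S, p.eval a = 0) (hcard : S.card = p.degree) (x : R) :
    p.eval x = p.leadingCoeff * ∏ a ∈ S, (x - a) := by
  have hroots : p.roots = S.val := roots_eq_of_degree_eq_card hS hcard
  have hroots_card : p.roots.card = p.natDegree := by
    rw [hroots]
    exact (natDegree_eq_of_degree_eq_some hcard.symm).symm
  conv_lhs => rw [← C_leadingCoeff_mul_prod_multiset_X_sub_C hroots_card, hroots]
  simp only [eval_mul, eval_C, eval_multiset_prod, Multiset.map_map, Function.comp_def, eval_sub,
    eval_X]
  rfl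

lemma quartic_neg (γ δ E v : ℝ) : quartic γ δ E (-v) = quartic γ δ E v := by
  unfold quartic
  ring

lemma quartic_sqrt {γ δ E w : ℝ} (hw : 0 ≤ w) :
    quartic γ δ E √w = γ * w ^ 2 - δ + 2 * E * w := by
  rw [quartic, show √w ^ 4 = (√w ^ 2) ^ 2 by ring, sq_sqrt hw]

variable {γ δ E v₁ v₂ v₃ v₄ : ℝ}

open Polynomial in
lemma IsOrderedRoots.quartic_eq (h : IsOrderedRoots γ δ E v₁ v₂ v₃ v₄) (hγ : γ ≠ 0) :
    quartic γ δ E = rootQuartic γ v₁ v₂ v₃ v₄ := by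
  obtain ⟨h₁₂, h₂₃, h₃₄, r₁, r₂, r₃, r₄⟩ := h
  set p : ℝ[X] := C γ * X ^ 4 + C (2 * E) * X ^ 2 + C (-δ) with hp
  have hp_eval : ∀ v, p.eval v = quartic γ δ E v := fun v => by
    simp only [hp, quartic, eval_add, eval_mul, eval_pow, eval_C, eval_X]
    ring
  have hdeg : p.degree = 4 := by
    rw [hp]
    compute_degree!
  have hlead : p.leadingCoeff = γ := by
    rw [leadingCoeff, natDegree_eq_of_degree_eq_some hdeg]
    simp [hp, coeff_X_pow, -map_mul]
  have hcard : ({v₁, v₂, v₃, v₄} : Finset ℝ).card = 4 := by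
    grind
  have hroots : ∀ v ∈ ({v₁, v₂, v₃, v₄} : Finset ℝ), p.eval v = 0 := by
    simp [hp_eval, r₁, r₂, r₃, r₄]
  funext v
  rw [← hp_eval, eval_eq_leadingCoeff_mul_prod_sub hroots (by rw [hcard, hdeg]; rfl), hlead,
    Finset.prod_insert (by grind), Finset.prod_insert (by grind), Finset.prod_insert (by grind),
    Finset.prod_singleton, rootQuartic]
  ring

lemma IsOrderedRoots.symmetric (h : IsOrderedRoots γ δ E v₁ v₂ v₃ v₄) (hγ : γ ≠ 0) :
    v₃ = -v₂ ∧ v₄ = -v₁ := by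
  have heven : ∀ v, rootQuartic 1 v₁ v₂ v₃ v₄ v = rootQuartic 1 v₁ v₂ v₃ v₄ (-v) := fun v => by
    have := quartic_neg γ δ E v
    rw [h.quartic_eq hγ] at this
    simpa [rootQuartic, hγ, eq_comm] using this
  have heven₁ := heven 1
  have heven₂ := heven 2
  unfold rootQuartic at heven₁ heven₂
  have hsum : v₁ + v₂ + v₃ + v₄ = 0 := by linarith
  have hsum₃ : v₁ * v₂ * v₃ + v₁ * v₂ * v₄ + v₁ * v₃ * v₄ + v₂ * v₃ * v₄ = 0 := by linarith
  have hpairs : (v₁ + v₂) * (v₁ + v₃) * (v₁ + v₄) = 0 := by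
    linear_combination v₁ ^ 2 * hsum + hsum₃
  obtain ⟨h₁₂, h₂₃, h₃₄, -, -, -, -⟩ := h
  rcases mul_eq_zero.1 hpairs with hpair | h₁₄
  · rcases mul_eq_zero.1 hpair with h₁₂' | h₁₃ <;> exfalso <;> linarith
  · exact ⟨by linarith, by linarith⟩

lemma IsOrderedRoots.coeffs (h : IsOrderedRoots γ δ E v₁ v₂ v₃ v₄) (hγ : γ ≠ 0) :
    δ = -(γ * (v₁ ^ 2 * v₂ ^ 2)) ∧ 2 * E = -(γ * (v₁ ^ 2 + v₂ ^ 2)) := by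
  obtain ⟨rfl, rfl⟩ := h.symmetric hγ
  have h₀ := congrFun (h.quartic_eq hγ) 0
  have h₁ := congrFun (h.quartic_eq hγ) 1
  unfold quartic rootQuartic at h₀ h₁
  exact ⟨by linarith, by linarith⟩

lemma isOrderedRoots_of_pos_of_lt (h₂ : 0 < v₂) (h₁₂ : v₂ < v₁) (r₁ : quartic γ δ E v₁ = 0)
    (r₂ : quartic γ δ E v₂ = 0) : IsOrderedRoots γ δ E v₁ v₂ (-v₂) (-v₁) where
  lt₁₂ := h₁₂
  lt₂₃ := by linarith
  lt₃₄ := neg_lt_neg h₁₂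
  root₁ := r₁
  root₂ := r₂
  root₃ := by rw [quartic_neg, r₂]
  root₄ := by rw [quartic_neg, r₁]

lemma IsOrderedRoots.coeff_lt (h : IsOrderedRoots γ δ E v₁ v₂ v₃ v₄) (hγ : 0 < γ) :
    δ < 0 ∧ E < -√(γ * -δ) := by
  obtain ⟨hδ, hE⟩ := h.coeffs hγ.ne'
  have hv₂ : 0 < v₂ := by linarith [h.lt₂₃, (h.symmetric hγ.ne').1]
  have hv₁ : 0 < v₁ := hv₂.trans h.lt₁₂
  have hsqrt : √(γ * -δ) = γ * (v₁ * v₂) := by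
    rw [hδ, show γ * -(-(γ * (v₁ ^ 2 * v₂ ^ 2))) = (γ * (v₁ * v₂)) ^ 2 by ring]
    exact sqrt_sq (by positivity)
  have hδ_pos : 0 < γ * (v₁ ^ 2 * v₂ ^ 2) := by positivity
  have hamgm : 0 < γ * (v₁ - v₂) ^ 2 := mul_pos hγ (pow_pos (sub_pos.2 h.lt₁₂) 2)
  exact ⟨by linarith, by linarith⟩

lemma exists_isOrderedRoots_of_lt (hγ : 0 < γ) (hδ : δ < 0) (hE : E < -√(γ * -δ)) :
    ∃ v₁ v₂ v₃ v₄, IsOrderedRoots γ δ E v₁ v₂ v₃ v₄ := by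
  have hγδ : γ * δ < 0 := mul_neg_of_pos_of_neg hγ hδ
  have hE_neg : 0 < -E := (sqrt_nonneg _).trans_lt (lt_neg.1 hE)
  have hdisc : 0 < E ^ 2 + γ * δ := by
    linarith [(sqrt_lt' hE_neg).1 (lt_neg.1 hE)]
  have hr : √(E ^ 2 + γ * δ) ^ 2 = E ^ 2 + γ * δ := sq_sqrt hdisc.le
  have hr_pos : 0 < √(E ^ 2 + γ * δ) := sqrt_pos.2 hdisc
  have hr_lt : √(E ^ 2 + γ * δ) < -E := (sqrt_lt' hE_neg).2 (by linarith)
  generalize √(E ^ 2 + γ * δ) = r at hr hr_pos hr_lt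
  have hroot : ∀ ε, ε ^ 2 = r ^ 2 → 0 < -E + ε → quartic γ δ E √((-E + ε) / γ) = 0 := by
    intro ε hε hpos
    rw [quartic_sqrt (div_pos hpos hγ).le]
    field_simp
    linear_combination hε + hr
  have hw_pos : 0 < (-E + -r) / γ := div_pos (by linarith) hγ
  have hw_lt : (-E + -r) / γ < (-E + r) / γ := div_lt_div_of_pos_right (by linarith) hγ
  exact ⟨_, _, _, _, isOrderedRoots_of_pos_of_lt (sqrt_pos.2 hw_pos)
    (sqrt_lt_sqrt hw_pos.le hw_lt) (hroot r rfl (by linarith))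
    (hroot (-r) (neg_sq r) (by linarith))⟩

lemma exists_isOrderedRoots_iff (hγ : 0 < γ) :
    (∃ v₁ v₂ v₃ v₄, IsOrderedRoots γ δ E v₁ v₂ v₃ v₄) ↔ δ < 0 ∧ E < -√(γ * -δ) :=
  ⟨fun ⟨_, _, _, _, h⟩ => h.coeff_lt hγ, fun ⟨hδ, hE⟩ => exists_isOrderedRoots_of_lt hγ hδ hE⟩

end EvenQuartic

end Elliptic

open Elliptic in
theorem mainTheorem10_general {γ v₁ v₂ v₃ v₄ : ℝ} (hγ : 0 < γ) (h₁₂ : v₂ < v₁) (h₂₃ : v₃ < v₂)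
    (h₃₄ : v₄ < v₃) :
    (modulus v₁ v₂ v₃ v₄ ^ 2 = (v₄ - v₁) / (v₄ - v₂) * ((v₂ - v₃) / (v₁ - v₃)) ∧
      0 < modulus v₁ v₂ v₃ v₄ ∧ modulus v₁ v₂ v₃ v₄ < 1) ∧
    snSolution γ v₁ v₂ v₃ v₄ 0 = v₁ ∧
    (∀ t : ℝ, den γ v₁ v₂ v₃ v₄ t ≠ 0 →
      ∃ d : ℝ, HasDerivAt (snSolution γ v₁ v₂ v₃ v₄) d t ∧
        d ^ 2 = rootQuartic γ v₁ v₂ v₃ v₄ (snSolution γ v₁ v₂ v₃ v₄ t)) ∧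
    (∀ x : ℝ, v₁ ≤ x →
      IntervalIntegrable (fun s : ℝ => 1 / √(rootQuartic γ v₁ v₂ v₃ v₄ s))
        MeasureTheory.volume v₁ x ∧
      ∀ t : ℝ, 0 ≤ t →
        ((∫ s in v₁..x, 1 / √(rootQuartic γ v₁ v₂ v₃ v₄ s)) = t ↔
          (∀ τ ∈ Set.Icc 0 t, 0 < den γ v₁ v₂ v₃ v₄ τ) ∧
            x = snSolution γ v₁ v₂ v₃ v₄ t)) ∧
    ∀ (a b : ℝ) (v v' : ℝ → ℝ),
      (∀ t ∈ Set.Ioo a b, v₁ < v t ∧ HasDerivAt v (v' t) t ∧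
        v' t ^ 2 = rootQuartic γ v₁ v₂ v₃ v₄ (v t)) →
      ∃ t₀ : ℝ, ∀ t ∈ Set.Ioo a b,
        den γ v₁ v₂ v₃ v₄ (t - t₀) ≠ 0 ∧ v t = snSolution γ v₁ v₂ v₃ v₄ (t - t₀) :=
  ⟨⟨modulus_sq h₁₂ h₂₃ h₃₄, modulus_pos h₁₂ h₂₃ h₃₄, modulus_lt_one h₁₂ h₂₃ h₃₄⟩,
    snSolution_zero h₁₂ h₂₃ h₃₄,
    fun _ ht => ⟨_, hasDerivAt_snSolution h₁₂ h₂₃ h₃₄ ht, snVelocity_sq h₁₂ h₂₃ h₃₄ hγ ht⟩,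
    fun _ hx => ⟨intervalIntegrable_one_div_sqrt_rootQuartic h₁₂ h₂₃ h₃₄ hγ hx,
      fun _ ht => integral_one_div_sqrt_rootQuartic_eq_iff h₁₂ h₂₃ h₃₄ hγ hx ht⟩,
    fun _ _ _ _ hv => exists_eq_snSolution_sub h₁₂ h₂₃ h₃₄ hγ hv⟩

theorem mainTheorem10 (γ δ E : ℝ) (hγ : 0 < γ) :
    -- when the quartic has four distinct real roots
    ((∃ v₁ v₂ v₃ v₄ : ℝ, Elliptic.IsOrderedRoots γ δ E v₁ v₂ v₃ v₄) ↔
      δ < 0 ∧ E < -√(γ * -δ)) ∧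
    ∀ v₁ v₂ v₃ v₄ : ℝ, Elliptic.IsOrderedRoots γ δ E v₁ v₂ v₃ v₄ →
      -- the modulus
      (Elliptic.modulus v₁ v₂ v₃ v₄ ^ 2 =
          (v₄ - v₁) / (v₄ - v₂) * ((v₂ - v₃) / (v₁ - v₃)) ∧
        0 < Elliptic.modulus v₁ v₂ v₃ v₄ ∧ Elliptic.modulus v₁ v₂ v₃ v₄ < 1) ∧
      -- the expression solves the first integral wherever its denominator does not vanish
      Elliptic.snSolution γ v₁ v₂ v₃ v₄ 0 = v₁ ∧
      (∀ t : ℝ, Elliptic.den γ v₁ v₂ v₃ v₄ t ≠ 0 →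
        ∃ d : ℝ, HasDerivAt (Elliptic.snSolution γ v₁ v₂ v₃ v₄) d t ∧
          d ^ 2 = Elliptic.quartic γ δ E (Elliptic.snSolution γ v₁ v₂ v₃ v₄ t)) ∧
      -- it inverts the elliptic integral based at the largest root
      (∀ x : ℝ, v₁ ≤ x →
        IntervalIntegrable (fun s : ℝ => 1 / √(Elliptic.quartic γ δ E s))
          MeasureTheory.volume v₁ x ∧
        ∀ t : ℝ, 0 ≤ t →
          ((∫ s in v₁..x, 1 / √(Elliptic.quartic γ δ E s)) = t ↔
            (∀ τ ∈ Set.Icc 0 t, 0 < Elliptic.den γ v₁ v₂ v₃ v₄ τ) ∧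
              x = Elliptic.snSolution γ v₁ v₂ v₃ v₄ t)) ∧
      -- every solution above the largest root is a time translate of it
      (∀ (a b : ℝ) (v v' : ℝ → ℝ), a < b →
        (∀ t ∈ Set.Ioo a b, v₁ < v t ∧ HasDerivAt v (v' t) t ∧
          v' t ^ 2 = Elliptic.quartic γ δ E (v t)) →
        ∃ t₀ : ℝ, ∀ t ∈ Set.Ioo a b,
          Elliptic.den γ v₁ v₂ v₃ v₄ (t - t₀) ≠ 0 ∧
            v t = Elliptic.snSolution γ v₁ v₂ v₃ v₄ (t - t₀)) := by
  refine ⟨Elliptic.exists_isOrderedRoots_iff hγ, fun v₁ v₂ v₃ v₄ h => ?_⟩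
  obtain ⟨hmodulus, hzero, hode, hintegral, htranslate⟩ :=
    mainTheorem10_general hγ h.lt₁₂ h.lt₂₃ h.lt₃₄
  rw [h.quartic_eq hγ.ne']
  exact ⟨hmodulus, hzero, hode, hintegral, fun a b v v' _ hv => htranslate a b v v' hv⟩
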